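/- Let $p\ge 3$ be a prime and let $k$ be an algebraically closed field of characteristic $p$. For a polynomial $P\in k[X]$ put $\wp(P)=P^p-P$, and for $f\in k[X]$ let $\mathrm{red}(f)$ be the unique polynomial congruent to $f$ modulo $\wp(k[X])$ in which only monomials of degree prime to $p$ occur. Let $S=\wp(X)=X^p-X$ and $Q=\wp(S)$, and let $V\subset k$ be the group of zeros of $Q$. For $1\le i\le p-2$ put $g_i=\frac{S^{i+1}}{(i+1)!}$, let $g_{p-1}\in k[X]$ be the reduction modulo $p$ of $\frac1{p!}\left((X^p-X)^p-X^{p^2}+X^p\right)\in W(k)[X]$, where $W(k)$ is the ring of Witt vectors of $k$, and put $f_i=\mathrm{red}(g_i)$. For $1\le n\le p-1$ let $C[n]$ be the curve with function field $K_n=k(X,W_1,\dots,W_n)$ given by the Artin–Schreier equations $W_i^p-W_i=f_i(X)$, $1\le i\le n$, and let $G[n]$ be the group of all $k$-automorphisms of $K_n$ (that is, automorphisms of $C[n]$) that extend a translation $X\mapsto X+y$ of the affine line with $y\in V$. A group $G$ is called capable if $G\simeq\Gamma/Z(\Gamma)$ for some group $\Gamma$, where $Z(\Gamma)$ is the center of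 $\Gamma$. A finite $p$-group $E$ is called extraspecial if $Z(E)$ has order $p$ and $E/Z(E)$ is a nontrivial elementary abelian $p$-group. 1. For every $n$ with $2\le n\le p-1$, $G[n-1]\simeq G[n]/Z(G[n])$; hence $G[n-1]$ is capable, with $\Gamma=G[n]$. 2. In particular, the extraspecial group of order $p^3$ and exponent $p$ is capable with $\Gamma=G[2]$, a group of order $p^4$. That is: $G[1]$ is extraspecial of order $p^3$ and exponent $p$; every extraspecial group $E$ of order $p^3$ and exponent $p$ satisfies $E\simeq G[2]/Z(G[2])$ and so is capable; and $|G[2]|=p^4$. -/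

import Mathlib

open Polynomial

/-- The operator `℘`: Frobenius minus identity, on polynomials over a field of characteristic `p`. -/
noncomputable def wp (p : ℕ) {k : Type*} [Field k] (P : k[X]) : k[X] := P ^ p - P

/-- `r` is a reduced representative of `f`: only monomials of degree prime to `p` occur in `r`,
and `r` is congruent to `f` modulo `℘(k[X])`. -/
def IsReducedRep (p : ℕ) {k : Type*} [Field k] (f r : k[X]) : Prop :=
  (∀ i : ℕ, r.coeff i ≠ 0 → Nat.Coprime i p) ∧ ∃ P : k[X], f - r = wp p P

section

variable (p : ℕ) [Fact p.Prime] {k : Type*} [Field k] [CharP k p]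

theorem wp_add (P Q : k[X]) : wp p (P + Q) = wp p P + wp p Q := by
  simp only [wp, add_pow_char]; ring

theorem wp_sub (P Q : k[X]) : wp p (P - Q) = wp p P - wp p Q := by
  simp only [wp, sub_pow_char]; ring

theorem IsReducedRep.add {f₁ f₂ r₁ r₂ : k[X]} (h₁ : IsReducedRep p f₁ r₁)
    (h₂ : IsReducedRep p f₂ r₂) : IsReducedRep p (f₁ + f₂) (r₁ + r₂) := by
  obtain ⟨c₁, P₁, e₁⟩ := h₁
  obtain ⟨c₂, P₂, e₂⟩ := h₂
  refine ⟨fun i hi => ?_, P₁ + P₂, ?_⟩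
  · by_cases h : r₁.coeff i = 0
    · exact c₂ i (by simpa [h] using hi)
    · exact c₁ i h
  · rw [wp_add, ← e₁, ← e₂]; ring

variable [IsAlgClosed k]

theorem exists_isReducedRep_monomial (i : ℕ) (a : k) :
    ∃ r, IsReducedRep p (monomial i a) r := by
  have hp : p.Prime := Fact.out
  induction i using Nat.strong_induction_on generalizing a with
  | _ i ih =>
    by_cases hpi : p ∣ i
    · rcases Nat.eq_zero_or_pos i with rfl | hi
      · obtain ⟨c, hc⟩ := IsAlgClosed.exists_root (X ^ p - X - C a : k[X]) (by
          have : (X ^ p - X - C a : k[X]).degree = p := by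
            rw [sub_sub, degree_sub_eq_left_of_degree_lt]
            · simp
            · rw [degree_X_pow, degree_X_add_C]; exact_mod_cast hp.one_lt
          rw [this]; exact_mod_cast hp.ne_zero)
        refine ⟨0, by simp, C c, ?_⟩
        simp only [IsRoot, eval_sub, eval_pow, eval_X, eval_C] at hc
        rw [wp, ← C_pow, ← C_sub, sub_eq_zero.mp hc, sub_zero]; rfl
      · obtain ⟨m, rfl⟩ := hpi
        obtain ⟨b, hb⟩ := IsAlgClosed.exists_pow_nat_eq a hp.pos
        have hm : 0 < m := Nat.pos_of_mul_pos_left hi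
        obtain ⟨r, hr, P, hP⟩ := ih m (by nlinarith [hp.two_le]) b
        refine ⟨r, hr, monomial m b + P, ?_⟩
        rw [wp_add, ← hP, wp, monomial_pow, hb, mul_comm m p]; ring
    · refine ⟨monomial i a, fun j hj => ?_, 0, by simp [wp, hp.ne_zero]⟩
      rw [coeff_monomial] at hj
      have : i = j := by by_contra h; simp [h] at hj
      subst this
      exact ((Nat.Prime.coprime_iff_not_dvd hp).mpr hpi).symm

theorem existsUnique_isReducedRep (f : k[X]) : ∃! r, IsReducedRep p f r := by
  have hp : p.Prime := Fact.out
  apply existsUnique_of_exists_of_unique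
  · induction f using Polynomial.induction_on' with
    | add f g hf hg =>
      obtain ⟨r, hr⟩ := hf
      obtain ⟨s, hs⟩ := hg
      exact ⟨r + s, hr.add p hs⟩
    | monomial i a => exact exists_isReducedRep_monomial p i a
  · rintro r s ⟨hr, P, hP⟩ ⟨hs, R, hR⟩
    have e : s - r = wp p (P - R) := by rw [wp_sub, ← hP, ← hR]; ring
    have hc : ∀ i, p ∣ i → (s - r).coeff i = 0 := by
      intro i hi
      have hn : ¬ Nat.Coprime i p := fun h =>
        (Nat.Prime.coprime_iff_not_dvd hp).mp h.symm hi
      have h1 : r.coeff i = 0 := by by_contra h; exact hn (hr i h)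
      have h2 : s.coeff i = 0 := by by_contra h; exact hn (hs i h)
      rw [coeff_sub, h1, h2, sub_zero]
    rcases Nat.eq_zero_or_pos (P - R).natDegree with h0 | hd
    · obtain ⟨c, hcc⟩ := natDegree_eq_zero.mp h0
      rw [← hcc, wp, ← C_pow, ← C_sub] at e
      have := hc 0 (dvd_zero p)
      rw [e, coeff_C_zero] at this
      rw [this, C_0] at e
      exact (sub_eq_zero.mp e).symm
    · exfalso
      have := hc ((P - R).natDegree * p) (dvd_mul_left _ _)
      rw [e, wp, coeff_sub, mul_comm, coeff_pow_mul_natDegree,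
        coeff_eq_zero_of_natDegree_lt (by nlinarith [hp.two_le]), sub_zero] at this
      have h1 := pow_eq_zero_iff (hp.ne_zero) |>.mp this
      rw [leadingCoeff_eq_zero] at h1
      simp [h1] at hd

/-- The reduced representative `red f` of a polynomial `f`. -/
noncomputable def redRep (f : k[X]) : k[X] := (existsUnique_isReducedRep p f).choose

theorem redRep_spec (f : k[X]) : IsReducedRep p f (redRep p f) :=
  (existsUnique_isReducedRep p f).choose_spec.1

end

section

variable (p : ℕ) (k : Type*) [Field k]

/-- `S = ℘(X) = X ^ p - X`. -/
noncomputable def polyS : k[X] := wp p X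

/-- `Q = ℘(S)`. -/
noncomputable def polyQ : k[X] := wp p (polyS p k)

/-- The reduction modulo `p` of the polynomial
`(1 / p!) ((X ^ p - X) ^ p - X ^ (p ^ 2) + X ^ p)` with coefficients in the Witt vectors of `k`,
by expanding the binomial; for `p ≠ 2` see `gLast_spec`. -/
noncomputable def gLast : k[X] :=
  ∑ j ∈ Finset.Ico 1 p,
    C ((-1) ^ j * ((j.factorial : k) * ((p - j).factorial : k))⁻¹) * X ^ (p * (p - j) + j)

/-- The polynomials `g_i`: `S ^ (i + 1) / (i + 1)!` for `1 ≤ i ≤ p - 2`, and `gLast` for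
`i = p - 1`. -/
noncomputable def polyG (i : ℕ) : k[X] :=
  if i = p - 1 then gLast p k else C (((i + 1).factorial : k)⁻¹) * polyS p k ^ (i + 1)

end

section

variable (p : ℕ) [hp : Fact p.Prime] (k : Type*) [Field k] [CharP k p]

/-- `gLast` is the reduction modulo `p` of the stated polynomial over the Witt vectors. -/
theorem gLast_spec (hp2 : p ≠ 2) : ∃ G : (WittVector p k)[X],
    C (p.factorial : WittVector p k) * G = (X ^ p - X) ^ p - X ^ (p ^ 2) + X ^ p ∧
      G.map WittVector.constantCoeff = gLast p k := by
  have key : ∀ m : ℕ, ∃ c : WittVector p k, m.Coprime p → (m : WittVector p k) * c = 1 := by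
    intro m
    by_cases h : m.Coprime p
    · have hu : IsUnit (m : WittVector p k) := by
        apply WittVector.isUnit_of_coeff_zero_ne_zero
        have e : (m : WittVector p k).coeff 0 = (m : k) :=
          map_natCast (WittVector.constantCoeff (p := p) (R := k)) m
        rw [e, Ne, CharP.cast_eq_zero_iff k p]
        exact (Nat.Prime.coprime_iff_not_dvd hp.out).mp h.symm
      obtain ⟨c, hc⟩ := hu.exists_right_inv
      exact ⟨c, fun _ => hc⟩
    · exact ⟨0, fun h' => absurd h' h⟩
  choose c hc using key
  have hcop : ∀ j ∈ Finset.Ico 1 p, (j.factorial * (p - j).factorial).Coprime p := by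
    intro j hj
    rw [Finset.mem_Ico] at hj
    exact Nat.Coprime.mul_left (hp.out.coprime_factorial_of_lt (by omega)).symm
      (hp.out.coprime_factorial_of_lt (by omega)).symm
  refine ⟨∑ j ∈ Finset.Ico 1 p, C ((-1) ^ j * c (j.factorial * (p - j).factorial)) *
    X ^ (p * (p - j) + j), ?_, ?_⟩
  · have hodd : Odd p := hp.out.odd_of_ne_two hp2
    have hpos := hp.out.pos
    have e : (X ^ p - X : (WittVector p k)[X]) = -X + X ^ p := by ring
    rw [e, add_pow, Finset.sum_range_succ, Finset.range_eq_Ico,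
      Finset.sum_eq_sum_Ico_succ_bot hpos, Finset.mul_sum]
    have hz : ∀ j ∈ Finset.Ico 1 p, C (p.factorial : WittVector p k) *
        (C ((-1) ^ j * c (j.factorial * (p - j).factorial)) * X ^ (p * (p - j) + j)) =
        (-X) ^ j * (X ^ p) ^ (p - j) * ((p.choose j : ℕ) : (WittVector p k)[X]) := by
      intro j hj
      have h1 := hc _ (hcop j hj)
      rw [Finset.mem_Ico] at hj
      have h2 : (p.factorial : WittVector p k) * c (j.factorial * (p - j).factorial) =
          (p.choose j : WittVector p k) := by
        rw [← Nat.choose_mul_factorial_mul_factorial hj.2.le, mul_assoc, Nat.cast_mul, mul_assoc,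
          h1, mul_one]
      rw [← mul_assoc, ← C_mul, mul_left_comm, h2, C_mul, neg_pow (X : (WittVector p k)[X]) j, pow_add, pow_mul]
      simp only [map_pow, map_neg, map_one, map_natCast]
      ring
    rw [Finset.sum_congr rfl hz, zero_add]
    simp only [hodd.neg_pow, pow_zero, Nat.sub_zero, Nat.sub_self, Nat.choose_self,
      Nat.choose_zero_right, Nat.cast_one, mul_one, one_mul, ← pow_mul, sq]
    ring
  · rw [Polynomial.map_sum, gLast]
    refine Finset.sum_congr rfl fun j hj => ?_
    have h1 := congrArg WittVector.constantCoeff (hc _ (hcop j hj))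
    simp only [map_mul, map_natCast, map_one, Nat.cast_mul] at h1
    rw [Polynomial.map_mul, map_C, Polynomial.map_pow, map_X, map_mul, map_pow, map_neg, map_one,
      eq_inv_of_mul_eq_one_right h1]

/-- The group `V` of zeros of `Q`. -/
def zerosV : AddSubgroup k where
  carrier := {y | (polyQ p k).eval y = 0}
  zero_mem' := by simp [polyQ, polyS, wp, hp.out.ne_zero]
  add_mem' := by
    intro a b ha hb
    simp only [polyQ, polyS, wp, Set.mem_ofPred_eq, eval_sub, eval_pow, eval_X, add_pow_char,
      sub_pow_char] at *
    linear_combination ha + hb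
  neg_mem' := by
    intro a ha
    have h (x : k) : (-x) ^ p = - x ^ p := by
      have := sub_pow_char (0 : k) x (p := p); simpa [hp.out.ne_zero] using this
    simp only [polyQ, polyS, wp, Set.mem_ofPred_eq, eval_sub, eval_pow, eval_X, h,
      sub_pow_char] at *
    linear_combination - ha

variable [IsAlgClosed k]

/-- The polynomials `f_i = red g_i`. -/
noncomputable def polyF (i : ℕ) : k[X] := redRep p (polyG p k i)

/-- The function field `K_n = k(X, W_1, …, W_n)` of the curve `C[n]` parametrized by the
Artin-Schreier equations `W_i ^ p - W_i = f_i(X)`, `1 ≤ i ≤ n`, as a subfield of an algebraic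
closure of `k(X)`. Two roots of one such equation differ by an element of the prime field, so it
makes no difference whether one root or all of them are adjoined. -/
noncomputable def funField (n : ℕ) :
    IntermediateField (RatFunc k) (AlgebraicClosure (RatFunc k)) :=
  IntermediateField.adjoin (RatFunc k)
    {w | ∃ i : ℕ, 1 ≤ i ∧ i ≤ n ∧
      w ^ p - w = algebraMap (RatFunc k) _ (algebraMap k[X] (RatFunc k) (polyF p k i))}

/-- The element `X` of `K_n`. -/
noncomputable def coordX (n : ℕ) : funField p k n :=
  algebraMap (RatFunc k) (funField p k n) RatFunc.X

/-- The group `G[n]` of all `k`-automorphisms of `K_n` (automorphisms of the curve `C[n]`) that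
extend a translation `X ↦ X + y` of the affine line, `y ∈ V`. -/
noncomputable def groupG (n : ℕ) : Subgroup (funField p k n ≃ₐ[k] funField p k n) where
  carrier := {σ | ∃ y ∈ zerosV p k,
    σ (coordX p k n) = coordX p k n + algebraMap k (funField p k n) y}
  one_mem' := ⟨0, zero_mem _, by simp⟩
  mul_mem' := by
    rintro σ τ ⟨y, hy, h⟩ ⟨u, hu, h'⟩
    exact ⟨y + u, add_mem hy hu, by
      rw [AlgEquiv.mul_apply, h', map_add, h, AlgEquiv.commutes, map_add, add_assoc]⟩
  inv_mem' := by
    rintro σ ⟨y, hy, h⟩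
    refine ⟨-y, neg_mem hy, ?_⟩
    apply σ.injective
    rw [← AlgEquiv.mul_apply, mul_inv_cancel, map_add, h, AlgEquiv.commutes, map_neg]
    simp

end

/-- A group is capable if it is isomorphic to `Γ / Z(Γ)` for some group `Γ`. -/
def IsCapable.{u} (G : Type u) [Group G] : Prop :=
  ∃ (Γ : Type u) (_ : Group Γ), Nonempty (G ≃* Γ ⧸ Subgroup.center Γ)

/-- An extraspecial `p`-group: a finite `p`-group whose centre has order `p` and whose quotient by
its centre is a nontrivial elementary abelian `p`-group. -/
structure IsExtraspecial (p : ℕ) (G : Type*) [Group G] : Prop where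
  finite : Finite G
  isPGroup : IsPGroup p G
  card_center : Nat.card (Subgroup.center G) = p
  nontrivial : Nontrivial (G ⧸ Subgroup.center G)
  mul_comm : ∀ x y : G ⧸ Subgroup.center G, x * y = y * x
  pow_eq_one : ∀ x : G ⧸ Subgroup.center G, x ^ p = 1

/-!
Modulo `℘(k[X])`, the translation `X ↦ X + y` by a zero `y` of `Q` acts on `g_1, …, g_{p-1}` as
`exp (s N)`, where `s = ℘(y)` lies in the prime field and `N` is the shift `g_i ↦ g_{i-1}`
(`polyG_comp`). For `i ≤ p - 2` this is the binomial formula applied to `S(X + y) = S + s`. For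
`i = p - 1` it follows from the symmetric two-variable cocycle
`((a + b) ^ p - a ^ p - b ^ p) / p`: up to sign, `g_{p-1}` is its value at `(X ^ p, -X)`.

Every `K_n` lies in one algebraic closure of `k(X)`. Let `Ĝ` (`transGroup`) be the group of
`k`-automorphisms of that closure extending a translation by an element of `V`. With roots `W_i` of
the equations for the unreduced `g_i`, an element `σ` of `Ĝ` over `y` satisfies
`σ W_i = ∑ s ^ j / j! W_{i-j} + P(X)` (`exists_apply_elW_eq`); so `Ĝ` preserves each `K_n`, and it
restricts onto each `G[n]` because isomorphisms extend to algebraic closures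
(`restrictG_surjective`).

The main step is `restrictG_mem_center_iff`: the image of `σ` in `G[m + 1]` is central if and only
if its image in `G[m]` is trivial. If `σ` commutes on `W_1` with `τ` over `y'`, then
`℘(y') y = ℘(y) y'`; letting `y'` be `1` and a root of `℘(Y) = 1` gives `y = 0`. Then
`σ W_i = W_i + a_i` with `a_i` in the prime field, and commuting on `W_{i+1}` with a `τ` for which
`s = 1` forces `a_i = 0` for `i ≤ m`, by induction. Hence `G[m]` and `G[m + 1] / Z(G[m + 1])` are
quotients of `Ĝ` by the same kernel.

The centre of `G[m + 1]` embeds in the prime field by `σ ↦ a_{m+1}`, and it is not trivial since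
`G[m + 1]` is a nontrivial `p`-group. So it has order `p`, and `|G[n]| = p ^ (n + 2)` by induction
from `|G[0]| = |V| = p ^ 2`. In particular the Artin-Schreier extensions need not be shown to be
nontrivial beforehand. Finally, any two extraspecial groups of order `p ^ 3` and exponent `p` are
isomorphic because both have the coordinates of the Heisenberg group over `ZMod p`
(`exists_heisenberg_coordinates`).
-/

/-! ### The polynomials `g_i` and the operator `℘` -/

/-- Artin-Schreier equations are solvable over an algebraically closed field. -/
theorem exists_pow_sub_self_eq {p : ℕ} (hp : 1 < p) {F : Type*} [Field F] [IsAlgClosed F] (a : F) :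
    ∃ b : F, b ^ p - b = a := by
  obtain ⟨c, hc⟩ := IsAlgClosed.exists_root (X ^ p - X - C a : F[X]) (by
    have : (X ^ p - X - C a : F[X]).degree = p := by
      rw [sub_sub, degree_sub_eq_left_of_degree_lt]
      · simp
      · rw [degree_X_pow, degree_X_add_C]; exact_mod_cast hp
    rw [this]; exact_mod_cast (by omega))
  simp only [IsRoot, eval_sub, eval_pow, eval_X, eval_C] at hc
  exact ⟨c, sub_eq_zero.mp hc⟩

theorem polyG_of_lt (p : ℕ) {k : Type*} [Field k] {i : ℕ} (hi : i < p - 1) :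
    polyG p k i = C (((i + 1).factorial : k)⁻¹) * polyS p k ^ (i + 1) := by
  rw [polyG, if_neg hi.ne]

theorem polyG_last (p : ℕ) {k : Type*} [Field k] : polyG p k (p - 1) = gLast p k := by
  rw [polyG, if_pos rfl]

/-! ### The cocycle `((a + b) ^ p - a ^ p - b ^ p) / p` -/

/-- The integral polynomial `((a + b) ^ p - a ^ p - b ^ p) / p`, evaluated in a commutative ring;
the natural division `p.choose j / p` is exact. -/
def frobCocycle (p : ℕ) {R : Type*} [CommRing R] (a b : R) : R :=
  ∑ j ∈ Finset.Ico 1 p, ((p.choose j / p : ℕ) : R) * a ^ (p - j) * b ^ j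

theorem map_frobCocycle (p : ℕ) {R S : Type*} [CommRing R] [CommRing S] (φ : R →+* S) (a b : R) :
    φ (frobCocycle p a b) = frobCocycle p (φ a) (φ b) := by
  simp [frobCocycle, map_sum]

section

variable (p : ℕ) [hp : Fact p.Prime]

theorem mul_frobCocycle {R : Type*} [CommRing R] (a b : R) :
    (p : R) * frobCocycle p a b = (a + b) ^ p - a ^ p - b ^ p := by
  have hpos := hp.out.pos
  rw [add_comm a b, add_pow, Finset.sum_range_succ, Finset.range_eq_Ico,
    Finset.sum_eq_sum_Ico_succ_bot hpos, frobCocycle, Finset.mul_sum]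
  have : ∀ j ∈ Finset.Ico 1 p, (p : R) * (((p.choose j / p : ℕ) : R) * a ^ (p - j) * b ^ j) =
      b ^ j * a ^ (p - j) * (p.choose j : R) := by
    intro j hj
    rw [Finset.mem_Ico] at hj
    have h : p * (p.choose j / p) = p.choose j :=
      Nat.mul_div_cancel' (hp.out.dvd_choose_self (by omega) hj.2)
    rw [← mul_assoc, ← mul_assoc, ← Nat.cast_mul, h]
    ring
  rw [Finset.sum_congr rfl this]
  simp
  ring

theorem frobCocycle_add {R : Type*} [CommRing R] (a b c d : R) :
    frobCocycle p (a + c) (b + d) + frobCocycle p a c + frobCocycle p b d =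
      frobCocycle p a b + frobCocycle p c d + frobCocycle p (a + b) (c + d) := by
  -- in the universal case `ℤ[a, b, c, d]` it suffices to compare `p` times both sides
  have key : ∀ a b c d : MvPolynomial (Fin 4) ℤ,
      frobCocycle p (a + c) (b + d) + frobCocycle p a c + frobCocycle p b d =
        frobCocycle p a b + frobCocycle p c d + frobCocycle p (a + b) (c + d) := by
    intro a b c d
    have h0 : (p : MvPolynomial (Fin 4) ℤ) ≠ 0 := by exact_mod_cast hp.out.ne_zero
    apply mul_left_cancel₀ h0
    simp only [mul_add, mul_frobCocycle]
    ring
  have h := congrArg (MvPolynomial.aeval (R := ℤ) ![a, b, c, d]).toRingHom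
    (key (.X 0) (.X 1) (.X 2) (.X 3))
  simpa only [map_add, map_frobCocycle, AlgHom.toRingHom_eq_coe, RingHom.coe_coe,
    MvPolynomial.aeval_X, Matrix.cons_val] using h

theorem frobCocycle_neg (hp2 : p ≠ 2) {R : Type*} [CommRing R] (a b : R) :
    frobCocycle p (-a) (-b) = -frobCocycle p a b := by
  rw [frobCocycle, frobCocycle, ← Finset.sum_neg_distrib]
  refine Finset.sum_congr rfl fun j hj => ?_
  rw [Finset.mem_Ico] at hj
  have h : (-1 : R) ^ (p - j) * (-1) ^ j = -1 := by
    rw [← pow_add, Nat.sub_add_cancel hj.2.le, (hp.out.odd_of_ne_two hp2).neg_one_pow]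
  rw [neg_pow a, neg_pow b]
  linear_combination ((p.choose j / p : ℕ) : R) * a ^ (p - j) * b ^ j * h

section

variable {k : Type*} [Field k] [CharP k p]

theorem factorial_cast_ne_zero {m : ℕ} (hm : m < p) : (m.factorial : k) ≠ 0 := by
  rw [Ne, CharP.cast_eq_zero_iff k p, hp.out.dvd_factorial]
  omega

/-- By Wilson's theorem, `(p choose j) / p` is `-1 / (j! (p - j)!)` in characteristic `p`. -/
theorem choose_div_cast {j : ℕ} (h1 : 1 ≤ j) (hj : j < p) :
    ((p.choose j / p : ℕ) : k) = -((j.factorial : k) * ((p - j).factorial : k))⁻¹ := by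
  have hn : p.choose j / p * (j.factorial * (p - j).factorial) = (p - 1).factorial := by
    apply Nat.eq_of_mul_eq_mul_left hp.out.pos
    rw [← mul_assoc, Nat.mul_div_cancel' (hp.out.dvd_choose_self (by omega) hj),
      Nat.mul_factorial_pred hp.out.ne_zero, ← mul_assoc,
      Nat.choose_mul_factorial_mul_factorial hj.le]
  have hw : ((p - 1).factorial : k) = -1 := by
    have := congrArg (ZMod.castHom (dvd_refl p) k) (ZMod.wilsons_lemma p)
    rwa [map_natCast, map_neg, map_one] at this
  have h := congrArg (Nat.cast : ℕ → k) hn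
  rw [hw] at h
  push_cast at h
  rw [neg_inv]
  refine eq_inv_of_mul_eq_one_left ?_
  linear_combination -h

theorem gLast_eq : gLast p k = -frobCocycle p (X ^ p) (-X) := by
  rw [gLast, frobCocycle, ← Finset.sum_neg_distrib]
  refine Finset.sum_congr rfl fun j hj => ?_
  rw [Finset.mem_Ico] at hj
  rw [← C_eq_natCast, choose_div_cast p hj.1 hj.2, neg_pow (X : k[X]), pow_add, pow_mul]
  simp only [C_mul, C_pow, C_neg, C_1]
  ring

/-! ### Behaviour of the `g_i` under translations -/

/-- The subgroup `℘(k[X])` of `k[X]`. -/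
noncomputable def wpRange (k : Type*) [Field k] [CharP k p] : AddSubgroup k[X] :=
  (AddMonoidHom.mk' (wp p (k := k)) (wp_add p)).range

theorem C_mem_wpRange [IsAlgClosed k] (a : k) : C a ∈ wpRange p k := by
  obtain ⟨c, hc⟩ := exists_pow_sub_self_eq hp.out.one_lt a
  exact ⟨C c, by change wp p (C c) = _; rw [wp, ← C_pow, ← C_sub, hc]⟩

theorem C_mul_polyS_mem_wpRange {a : k} (ha : a ^ p = a) : C a * polyS p k ∈ wpRange p k := by
  refine ⟨C a * X, ?_⟩
  change wp p _ = _
  rw [wp, mul_pow, ← C_pow, ha, polyS, wp]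
  ring

theorem polyS_comp (y : k) : (polyS p k).comp (X + C y) = polyS p k + C (y ^ p - y) := by
  simp only [polyS, wp, sub_comp, pow_comp, X_comp, add_pow_char, C_sub, C_pow]
  ring

theorem pow_div_factorial_pow {s : k} (hs : s ^ p = s) (j : ℕ) :
    (s ^ j / (j.factorial : k)) ^ p = s ^ j / (j.factorial : k) := by
  have h : ((j.factorial : ℕ) : k) ^ p = j.factorial := by
    rw [← frobenius_def, map_natCast]
  rw [div_pow, h, ← pow_mul, mul_comm, pow_mul, hs]

theorem polyG_comp_of_lt [IsAlgClosed k] {i : ℕ} (hi : i < p - 1) {y s : k}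
    (hy : y ^ p - y = s) (hs : s ^ p = s) :
    (polyG p k i).comp (X + C y) -
      ∑ j ∈ Finset.range i, C (s ^ j / (j.factorial : k)) * polyG p k (i - j) ∈ wpRange p k := by
  have e : (polyG p k i).comp (X + C y) =
      ∑ j ∈ Finset.range (i + 2), C (s ^ j / (j.factorial : k)) *
        (C (((i + 1 - j).factorial : k)⁻¹) * polyS p k ^ (i + 1 - j)) := by
    rw [polyG_of_lt p hi, mul_comp, C_comp, pow_comp, polyS_comp, hy, add_comm (polyS p k),
      add_pow, Finset.mul_sum]
    refine Finset.sum_congr rfl fun j hj => ?_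
    have hj' : j ≤ i + 1 := by simp at hj; omega
    have h1 := factorial_cast_ne_zero p (k := k) (show j < p by omega)
    have h2 := factorial_cast_ne_zero p (k := k) (show i + 1 - j < p by omega)
    have h3 := factorial_cast_ne_zero p (k := k) (show i + 1 < p by omega)
    have hc : (((i + 1).factorial : k))⁻¹ * ((i + 1).choose j : k) =
        (j.factorial : k)⁻¹ * ((i + 1 - j).factorial : k)⁻¹ := by
      have := congrArg (Nat.cast : ℕ → k) (Nat.choose_mul_factorial_mul_factorial hj')
      push_cast at this
      field_simp
      linear_combination this
    rw [← C_eq_natCast, div_eq_mul_inv, C_mul, C_pow]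
    have hc' := congrArg (C : k → k[X]) hc
    simp only [C_mul] at hc'
    linear_combination C s ^ j * polyS p k ^ (i + 1 - j) * hc'
  have e2 : ∑ j ∈ Finset.range i, C (s ^ j / (j.factorial : k)) * polyG p k (i - j) =
      ∑ j ∈ Finset.range i, C (s ^ j / (j.factorial : k)) *
        (C (((i + 1 - j).factorial : k)⁻¹) * polyS p k ^ (i + 1 - j)) := by
    refine Finset.sum_congr rfl fun j hj => ?_
    rw [Finset.mem_range] at hj
    rw [polyG_of_lt p (by omega), show i - j + 1 = i + 1 - j by omega]
  rw [e, e2, Finset.sum_range_succ, Finset.sum_range_succ, add_sub_right_comm, add_sub_cancel_left]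
  apply add_mem
  · simpa using C_mul_polyS_mem_wpRange p (pow_div_factorial_pow p hs i)
  · simpa using C_mem_wpRange p (s ^ (i + 1) / ((i + 1).factorial : k))

theorem gLast_comp [IsAlgClosed k] (hp2 : p ≠ 2) {y s : k}
    (hy : y ^ p - y = s) (hs : s ^ p = s) :
    (gLast p k).comp (X + C y) - ∑ j ∈ Finset.range (p - 1),
      C (s ^ j / (j.factorial : k)) * polyG p k (p - 1 - j) ∈ wpRange p k := by
  have h3 : 3 ≤ p := by have := hp.out.two_le; omega
  have hS : (X : k[X]) ^ p + -X = polyS p k := by rw [polyS, wp, sub_eq_add_neg]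
  have hs' : (C y : k[X]) ^ p + -C y = C s := by rw [← hy, C_sub, C_pow, sub_eq_add_neg]
  have e1 : (gLast p k).comp (X + C y) =
      -frobCocycle p (X ^ p + C y ^ p) (-X + -C y) := by
    have := map_frobCocycle p (compRingHom (X + C y : k[X])) (X ^ p) (-X)
    simp only [coe_compRingHom] at this
    rw [gLast_eq, neg_comp, this]
    simp only [pow_comp, X_comp, neg_comp, add_pow_char]
    rw [neg_add]
  have e2 := frobCocycle_add p (X ^ p : k[X]) (-X) (C y ^ p) (-C y)
  rw [hS, hs', frobCocycle_neg p hp2] at e2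
  have e3 : frobCocycle p (X ^ p : k[X]) (C y ^ p) = frobCocycle p X (C y) ^ p := by
    have := map_frobCocycle p (frobenius k[X] p) X (C y)
    simpa only [frobenius_def] using this.symm
  have e4 : frobCocycle p (C y ^ p : k[X]) (-C y) = C (frobCocycle p (y ^ p) (-y)) := by
    rw [map_frobCocycle, C_neg, C_pow]
  have e5 : frobCocycle p (polyS p k) (C s) = - (∑ j ∈ Finset.Ico 1 (p - 1),
      C (s ^ j / (j.factorial : k)) * polyG p k (p - 1 - j)) -
      C (s ^ (p - 1) / ((p - 1).factorial : k)) * polyS p k := by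
    have hr : Finset.Ico 1 p = Finset.Ico 1 ((p - 1) + 1) := by
      rw [Nat.sub_add_cancel hp.out.one_le]
    rw [frobCocycle, hr, Finset.sum_Ico_succ_top (by omega), sub_eq_add_neg,
      ← Finset.sum_neg_distrib]
    congr 1
    · refine Finset.sum_congr rfl fun j hj => ?_
      rw [Finset.mem_Ico] at hj
      rw [polyG_of_lt p (by omega), show p - 1 - j + 1 = p - j by omega, ← C_eq_natCast,
        choose_div_cast p hj.1 (by omega), div_eq_mul_inv, mul_inv]
      simp only [C_mul, C_neg, C_pow]
      ring
    · rw [← C_eq_natCast, choose_div_cast p (by omega) (by omega), div_eq_mul_inv, mul_inv,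
        Nat.sub_sub_self hp.out.one_le]
      simp only [C_mul, C_neg, C_pow, Nat.factorial_one, Nat.cast_one, inv_one, C_1, pow_one]
      ring
  have e6 : ∑ j ∈ Finset.range (p - 1), C (s ^ j / (j.factorial : k)) * polyG p k (p - 1 - j) =
      gLast p k + ∑ j ∈ Finset.Ico 1 (p - 1),
        C (s ^ j / (j.factorial : k)) * polyG p k (p - 1 - j) := by
    rw [Finset.range_eq_Ico, Finset.sum_eq_sum_Ico_succ_bot (by omega)]
    simp [polyG_last]
  have e : (gLast p k).comp (X + C y) - ∑ j ∈ Finset.range (p - 1),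
      C (s ^ j / (j.factorial : k)) * polyG p k (p - 1 - j) =
      wp p (frobCocycle p X (C y)) - C (frobCocycle p (y ^ p) (-y)) +
        C (s ^ (p - 1) / ((p - 1).factorial : k)) * polyS p k := by
    rw [e1, e6, gLast_eq, wp]
    rw [e3, e4, e5] at e2
    linear_combination -e2
  rw [e]
  exact add_mem (sub_mem ⟨_, rfl⟩ (C_mem_wpRange p _))
    (C_mul_polyS_mem_wpRange p (pow_div_factorial_pow p hs _))

/-- Modulo `℘(k[X])`, translation by a zero `y` of `Q` acts on the `g_i` as `exp (s N)`, where
`s = ℘(y)` and `N` is the shift `g_i ↦ g_{i - 1}`, `g_1 ↦ 0`. -/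
theorem polyG_comp [IsAlgClosed k] (hp2 : p ≠ 2) {i : ℕ} (hi : i ≤ p - 1) {y s : k}
    (hy : y ^ p - y = s) (hs : s ^ p = s) :
    ∃ P, (polyG p k i).comp (X + C y) =
      ∑ j ∈ Finset.range i, C (s ^ j / (j.factorial : k)) * polyG p k (i - j) + wp p P := by
  have h : (polyG p k i).comp (X + C y) -
      ∑ j ∈ Finset.range i, C (s ^ j / (j.factorial : k)) * polyG p k (i - j) ∈ wpRange p k := by
    rcases hi.lt_or_eq with h | rfl
    · exact polyG_comp_of_lt p h hy hs
    · rw [polyG_last]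
      exact gLast_comp p hp2 hy hs
  obtain ⟨P, hP⟩ := h
  refine ⟨P, ?_⟩
  change wp p P = _ at hP
  rw [hP]
  ring

end

end

/-! ### Automorphisms of an algebraic closure of `k(X)` extending translations -/

/-- In characteristic `p` the solutions of `u ^ p = u` are the elements of the prime field. -/
theorem exists_zmod_val_of_pow_eq_self (p : ℕ) [Fact p.Prime] {F : Type*} [Field F] [CharP F p]
    {u : F} (h : u ^ p = u) : ∃ a : ZMod p, u = (a.val : F) := by
  let _ : Algebra (ZMod p) F := ZMod.algebra F p
  have h' := (Subfield.mem_bot_iff_pow_eq_self F p).mpr h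
  rw [Subfield.bot_eq_of_zMod_algebra p] at h'
  obtain ⟨a, rfl⟩ := h'
  refine ⟨a, ?_⟩
  conv_lhs => rw [← ZMod.natCast_zmod_val a]
  rw [map_natCast]

section

variable (p : ℕ) (k : Type*) [Field k]

/-- The element `X` in the algebraic closure of `k(X)`. -/
noncomputable def elX : AlgebraicClosure (RatFunc k) :=
  algebraMap (RatFunc k) (AlgebraicClosure (RatFunc k)) RatFunc.X

/-- A root `W_i` of `W ^ p - W = g_i(X)`. The unreduced `g_i` are used here because they transform
more simply under translations than the `f_i`; this changes `W_i` by a polynomial in `X`. -/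
noncomputable def elW (i : ℕ) : AlgebraicClosure (RatFunc k) :=
  if h : 1 < p then (exists_pow_sub_self_eq h (aeval (elX k) (polyG p k i))).choose else 0

variable {k}

theorem algebraMap_eq_aeval_elX (P : k[X]) :
    algebraMap (RatFunc k) (AlgebraicClosure (RatFunc k)) (algebraMap k[X] (RatFunc k) P) =
      aeval (elX k) P := by
  have : (IsScalarTower.toAlgHom k (RatFunc k) (AlgebraicClosure (RatFunc k))).comp
      (IsScalarTower.toAlgHom k k[X] (RatFunc k)) = aeval (elX k) := by
    ext
    simp [elX]
  exact DFunLike.congr_fun this P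

theorem elX_add_algebraMap_injective :
    Function.Injective (fun y : k => elX k + algebraMap k (AlgebraicClosure (RatFunc k)) y) :=
  (add_right_injective _).comp (algebraMap k _).injective

theorem apply_aeval_elX {σ : AlgebraicClosure (RatFunc k) ≃ₐ[k] AlgebraicClosure (RatFunc k)}
    {y : k} (h : σ (elX k) = elX k + algebraMap k _ y) (P : k[X]) :
    σ (aeval (elX k) P) = aeval (elX k) (P.comp (X + C y)) := by
  rw [← aeval_algHom_apply, h, aeval_comp]
  simp

theorem exists_algEquiv_apply_elX (y : k) :
    ∃ σ : AlgebraicClosure (RatFunc k) ≃ₐ[k] AlgebraicClosure (RatFunc k),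
      σ (elX k) = elX k + algebraMap k _ y := by
  let e : RatFunc k ≃+* RatFunc k :=
    IsFractionRing.ringEquivOfRingEquiv (algEquivAevalXAddC y).toRingEquiv
  have he : ∀ P : k[X], e (algebraMap k[X] (RatFunc k) P) =
      algebraMap k[X] (RatFunc k) (P.comp (X + C y)) := by
    intro P
    rw [IsFractionRing.ringEquivOfRingEquiv_algebraMap]
    rfl
  let f := IsAlgClosure.equivOfEquiv (AlgebraicClosure (RatFunc k)) (AlgebraicClosure (RatFunc k)) e
  have hf : ∀ P : k[X], f (aeval (elX k) P) = aeval (elX k) (P.comp (X + C y)) := by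
    intro P
    rw [← algebraMap_eq_aeval_elX, IsAlgClosure.equivOfEquiv_algebraMap, he,
      algebraMap_eq_aeval_elX]
  refine ⟨AlgEquiv.ofRingEquiv (f := f) fun a => ?_, ?_⟩
  · simpa using hf (C a)
  · simpa using hf X

end

theorem elW_pow_sub {p : ℕ} (hp : 1 < p) {k : Type*} [Field k] (i : ℕ) :
    elW p k i ^ p - elW p k i = aeval (elX k) (polyG p k i) := by
  rw [elW, dif_pos hp]
  exact (exists_pow_sub_self_eq hp _).choose_spec

theorem aeval_wp (p : ℕ) {k : Type*} [Field k] (P : k[X]) :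
    aeval (elX k) (wp p P) = aeval (elX k) P ^ p - aeval (elX k) P := by
  simp [wp]

section

variable (p : ℕ) [hp : Fact p.Prime] {k : Type*} [Field k] [CharP k p]

theorem mem_zerosV {y : k} : y ∈ zerosV p k ↔ (y ^ p - y) ^ p = y ^ p - y := by
  change (polyQ p k).eval y = 0 ↔ _
  simp [polyQ, polyS, wp, sub_eq_zero]

variable (k)

/-- The group of `k`-automorphisms of the algebraic closure of `k(X)` extending a translation
`X ↦ X + y` with `y ∈ V`. It restricts onto every `G[n]`. -/
noncomputable def transGroup :
    Subgroup (AlgebraicClosure (RatFunc k) ≃ₐ[k] AlgebraicClosure (RatFunc k)) where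
  carrier := {σ | ∃ y ∈ zerosV p k, σ (elX k) = elX k + algebraMap k _ y}
  one_mem' := ⟨0, zero_mem _, by simp⟩
  mul_mem' := by
    rintro σ τ ⟨y, hy, h⟩ ⟨u, hu, h'⟩
    exact ⟨y + u, add_mem hy hu, by
      rw [AlgEquiv.mul_apply, h', map_add, h, AlgEquiv.commutes, map_add, add_assoc]⟩
  inv_mem' := by
    rintro σ ⟨y, hy, h⟩
    refine ⟨-y, neg_mem hy, ?_⟩
    apply σ.injective
    rw [← AlgEquiv.mul_apply, mul_inv_cancel, map_add, h, AlgEquiv.commutes, map_neg]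
    simp

variable {k}

theorem exists_transGroup_apply_elX {y : k} (hy : y ∈ zerosV p k) :
    ∃ σ : transGroup p k, σ.1 (elX k) = elX k + algebraMap k _ y := by
  obtain ⟨σ, hσ⟩ := exists_algEquiv_apply_elX y
  exact ⟨⟨σ, y, hy, hσ⟩, hσ⟩

variable [IsAlgClosed k]

/-- The formula `σ W_i = ∑ s ^ j / j! W_{i - j} + P(X)` for an automorphism over the translation
by `y ∈ V`, with `s = ℘(y)`. -/
theorem exists_apply_elW_eq (hp2 : p ≠ 2) {i : ℕ} (hi : i ≤ p - 1) {y s : k}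
    (hy : y ^ p - y = s) (hs : s ^ p = s)
    {σ : AlgebraicClosure (RatFunc k) ≃ₐ[k] AlgebraicClosure (RatFunc k)}
    (h : σ (elX k) = elX k + algebraMap k _ y) :
    ∃ P : k[X], σ (elW p k i) =
      ∑ j ∈ Finset.range i, algebraMap k _ (s ^ j / (j.factorial : k)) * elW p k (i - j) +
        aeval (elX k) P := by
  obtain ⟨P, hP⟩ := polyG_comp p hp2 hi hy hs
  set T := ∑ j ∈ Finset.range i,
    algebraMap k (AlgebraicClosure (RatFunc k)) (s ^ j / (j.factorial : k)) * elW p k (i - j)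
    with hT
  have hTp : T ^ p - T = aeval (elX k) (∑ j ∈ Finset.range i,
      C (s ^ j / (j.factorial : k)) * polyG p k (i - j)) := by
    rw [hT, sum_pow_char, ← Finset.sum_sub_distrib, map_sum]
    refine Finset.sum_congr rfl fun j _ => ?_
    rw [mul_pow, ← map_pow, pow_div_factorial_pow p hs, map_mul, aeval_C,
      ← elW_pow_sub hp.out.one_lt]
    ring
  have hσ := congrArg σ (elW_pow_sub hp.out.one_lt (k := k) i)
  rw [apply_aeval_elX h, hP, map_add, ← hTp, aeval_wp, map_sub, map_pow] at hσ
  obtain ⟨a, ha⟩ := exists_zmod_val_of_pow_eq_self p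
    (u := σ (elW p k i) - T - aeval (elX k) P) (by
      rw [sub_pow_char, sub_pow_char]
      linear_combination hσ)
  refine ⟨P + C (a.val : k), ?_⟩
  rw [map_add, aeval_C, map_natCast, ← ha]
  ring

/-- The explicit form of the action on `W_1`: no polynomial of higher degree in `X` intervenes. -/
theorem exists_apply_elW_one_eq (h3 : 3 ≤ p) {y s : k} (hy : y ^ p - y = s) (hs : s ^ p = s)
    {σ : AlgebraicClosure (RatFunc k) ≃ₐ[k] AlgebraicClosure (RatFunc k)}
    (h : σ (elX k) = elX k + algebraMap k _ y) :
    ∃ c : k, σ (elW p k 1) = elW p k 1 + algebraMap k _ s * elX k + algebraMap k _ c := by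
  have h2 : (2 : k) ≠ 0 := by
    have := factorial_cast_ne_zero p (k := k) (show 2 < p by omega)
    simpa using this
  obtain ⟨c, hc⟩ := exists_pow_sub_self_eq hp.out.one_lt (s ^ 2 / 2)
  have hG : (polyG p k 1).comp (X + C y) =
      polyG p k 1 + C s * (X ^ p - X) + C (c ^ p - c) := by
    rw [polyG_of_lt p (by omega), mul_comp, C_comp, pow_comp, polyS_comp, hy, hc]
    have e : (C ((2 : k)⁻¹) : k[X]) * 2 = 1 := by
      rw [show (2 : k[X]) = C 2 from rfl, ← C_mul, inv_mul_cancel₀ h2, C_1]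
    simp only [Nat.reduceAdd, Nat.factorial_two, Nat.cast_ofNat, div_eq_mul_inv, C_mul, C_pow]
    rw [polyS, wp]
    linear_combination C s * (X ^ p - X) * e
  have hσ := congrArg σ (elW_pow_sub hp.out.one_lt (k := k) 1)
  rw [apply_aeval_elX h, hG, map_sub, map_pow] at hσ
  simp only [map_add, map_mul, map_sub, map_pow, aeval_X, aeval_C,
    ← elW_pow_sub hp.out.one_lt] at hσ
  have hs' := congrArg (algebraMap k (AlgebraicClosure (RatFunc k))) hs
  rw [map_pow] at hs'
  obtain ⟨a, ha⟩ := exists_zmod_val_of_pow_eq_self p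
    (u := σ (elW p k 1) - elW p k 1 - algebraMap k _ s * elX k - algebraMap k _ c) (by
      rw [sub_pow_char, sub_pow_char, sub_pow_char, mul_pow, hs']
      linear_combination hσ)
  refine ⟨c + (a.val : k), ?_⟩
  rw [map_add, map_natCast, ← ha]
  ring

/-! ### Restriction to the fields `K_n` -/

theorem aeval_elX_mem_funField (n : ℕ) (P : k[X]) : aeval (elX k) P ∈ funField p k n := by
  rw [← algebraMap_eq_aeval_elX]
  exact (funField p k n).algebraMap_mem _

theorem elX_mem_funField (n : ℕ) : elX k ∈ funField p k n :=
  (funField p k n).algebraMap_mem _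

theorem elW_mem_funField {i n : ℕ} (h1 : 1 ≤ i) (hi : i ≤ n) : elW p k i ∈ funField p k n := by
  obtain ⟨P, hP⟩ := (redRep_spec p (polyG p k i)).2
  have h : elW p k i - aeval (elX k) P ∈ funField p k n := by
    refine IntermediateField.subset_adjoin _ _ ⟨i, h1, hi, ?_⟩
    have e : polyF p k i = polyG p k i - wp p P := by rw [← hP, polyF]; ring
    rw [algebraMap_eq_aeval_elX, e, map_sub, aeval_wp, ← elW_pow_sub hp.out.one_lt, sub_pow_char]
    ring
  have := add_mem h (aeval_elX_mem_funField p n P)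
  rwa [sub_add_cancel] at this

/-- Every generator of `K_n` is a `W_i` up to a polynomial in `X`. -/
theorem exists_eq_elW_add {i : ℕ} {w : AlgebraicClosure (RatFunc k)}
    (h : w ^ p - w = algebraMap (RatFunc k) _ (algebraMap k[X] (RatFunc k) (polyF p k i))) :
    ∃ P : k[X], w = elW p k i + aeval (elX k) P := by
  obtain ⟨P, hP⟩ := (redRep_spec p (polyG p k i)).2
  have e : polyF p k i = polyG p k i - wp p P := by rw [← hP, polyF]; ring
  rw [algebraMap_eq_aeval_elX, e, map_sub, aeval_wp, ← elW_pow_sub hp.out.one_lt] at h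
  obtain ⟨a, ha⟩ := exists_zmod_val_of_pow_eq_self p
    (u := w - elW p k i + aeval (elX k) P) (by
      rw [add_pow_char, sub_pow_char]
      linear_combination h)
  refine ⟨C (a.val : k) - P, ?_⟩
  rw [map_sub, aeval_C, map_natCast, ← ha]
  ring

/-- `K_n` is generated as a field by `k[X]` and `W_1, …, W_n`. In terms of a `Subfield` this
applies to preimages under automorphisms that do not fix `k(X)`. -/
theorem funField_le (n : ℕ) (F : Subfield (AlgebraicClosure (RatFunc k)))
    (hX : ∀ P : k[X], aeval (elX k) P ∈ F) (hW : ∀ i, 1 ≤ i → i ≤ n → elW p k i ∈ F)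
    {u : AlgebraicClosure (RatFunc k)} (hu : u ∈ funField p k n) : u ∈ F := by
  induction hu using IntermediateField.adjoin_induction with
  | mem w hw =>
    obtain ⟨i, h1, hi, h⟩ := hw
    obtain ⟨P, rfl⟩ := exists_eq_elW_add p h
    exact add_mem (hW i h1 hi) (hX P)
  | algebraMap r =>
    induction r using RatFunc.induction_on with
    | f P Q hQ =>
      rw [map_div₀, algebraMap_eq_aeval_elX, algebraMap_eq_aeval_elX]
      exact div_mem (hX P) (hX Q)
  | add u v _ _ hu hv => exact add_mem hu hv
  | inv u _ hu => exact inv_mem hu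
  | mul u v _ _ hu hv => exact mul_mem hu hv

theorem apply_mem_funField (hp2 : p ≠ 2) {n : ℕ} (hn : n ≤ p - 1)
    {σ : AlgebraicClosure (RatFunc k) ≃ₐ[k] AlgebraicClosure (RatFunc k)}
    (hσ : σ ∈ transGroup p k) {u : AlgebraicClosure (RatFunc k)} (hu : u ∈ funField p k n) :
    σ u ∈ funField p k n := by
  obtain ⟨y, hy, h⟩ := hσ
  rw [mem_zerosV] at hy
  refine funField_le p n ((funField p k n).toSubfield.comap (σ : _ →+* _)) (fun P => ?_)
    (fun i h1 hi => ?_) hu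
  · change σ _ ∈ funField p k n
    rw [apply_aeval_elX h]
    exact aeval_elX_mem_funField p n _
  · change σ _ ∈ funField p k n
    obtain ⟨P, hP⟩ := exists_apply_elW_eq p hp2 (hi.trans hn) rfl hy h
    rw [hP]
    refine add_mem (sum_mem fun j hj => mul_mem ?_ ?_) (aeval_elX_mem_funField p n P)
    · rw [← aeval_C (elX k)]
      exact aeval_elX_mem_funField p n _
    · rw [Finset.mem_range] at hj
      exact elW_mem_funField p (by omega) (by omega)

theorem apply_eq_of_forall_elW {n : ℕ}
    {σ τ : AlgebraicClosure (RatFunc k) ≃ₐ[k] AlgebraicClosure (RatFunc k)}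
    (hX : σ (elX k) = τ (elX k)) (hW : ∀ i, 1 ≤ i → i ≤ n → σ (elW p k i) = τ (elW p k i))
    {u : AlgebraicClosure (RatFunc k)} (hu : u ∈ funField p k n) : σ u = τ u := by
  refine funField_le p n ((σ : _ →+* AlgebraicClosure (RatFunc k)).eqLocusField (τ : _ →+* _))
    (fun P => ?_) (fun i h1 hi => ?_) hu
  · change σ _ = τ _
    rw [← aeval_algHom_apply, ← aeval_algHom_apply, hX]
  · exact hW i h1 hi

/-- Restriction to `K_n`, as a homomorphism onto `G[n]`. -/
noncomputable def restrictG (hp2 : p ≠ 2) {n : ℕ} (hn : n ≤ p - 1) :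
    transGroup p k →* groupG p k n where
  toFun σ := ⟨
    { toFun := fun u => ⟨σ.1 u, apply_mem_funField p hp2 hn σ.2 u.2⟩
      invFun := fun u => ⟨σ.1.symm u, apply_mem_funField p hp2 hn (inv_mem σ.2) u.2⟩
      left_inv := fun u => Subtype.ext (σ.1.symm_apply_apply _)
      right_inv := fun u => Subtype.ext (σ.1.apply_symm_apply _)
      map_mul' := fun u v => Subtype.ext (map_mul σ.1 _ _)
      map_add' := fun u v => Subtype.ext (map_add σ.1 _ _)
      commutes' := fun a => Subtype.ext (σ.1.commutes a) }, by
    obtain ⟨y, hy, h⟩ := σ.2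
    exact ⟨y, hy, Subtype.ext h⟩⟩
  map_one' := rfl
  map_mul' _ _ := rfl

theorem restrictG_apply (hp2 : p ≠ 2) {n : ℕ} (hn : n ≤ p - 1) (σ : transGroup p k)
    (u : funField p k n) : ((restrictG p hp2 hn σ).1 u : AlgebraicClosure (RatFunc k)) = σ.1 u :=
  rfl

theorem restrictG_eq_iff (hp2 : p ≠ 2) {n : ℕ} (hn : n ≤ p - 1) {σ τ : transGroup p k} :
    restrictG p hp2 hn σ = restrictG p hp2 hn τ ↔
      σ.1 (elX k) = τ.1 (elX k) ∧ ∀ i, 1 ≤ i → i ≤ n → σ.1 (elW p k i) = τ.1 (elW p k i) := by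
  constructor
  · intro h
    have key : ∀ u ∈ funField p k n, σ.1 u = τ.1 u := fun u hu => by
      rw [← restrictG_apply p hp2 hn σ ⟨u, hu⟩, h, restrictG_apply]
    exact ⟨key _ (elX_mem_funField p n), fun i h1 hi => key _ (elW_mem_funField p h1 hi)⟩
  · rintro ⟨hX, hW⟩
    apply Subtype.ext
    apply AlgEquiv.ext
    exact fun u => Subtype.ext (apply_eq_of_forall_elW p hX hW u.2)

theorem restrictG_surjective (hp2 : p ≠ 2) {n : ℕ} (hn : n ≤ p - 1) :
    Function.Surjective (restrictG p hp2 hn (k := k)) := by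
  rintro ⟨g, y, hy, h⟩
  have : IsAlgClosure (funField p k n) (AlgebraicClosure (RatFunc k)) :=
    ⟨inferInstance, Algebra.IsAlgebraic.tower_top (K := RatFunc k) _⟩
  let f := IsAlgClosure.equivOfEquiv (AlgebraicClosure (RatFunc k)) (AlgebraicClosure (RatFunc k))
    g.toRingEquiv
  have hf : ∀ u : funField p k n, f u = g u := fun u =>
    IsAlgClosure.equivOfEquiv_algebraMap _ _ g.toRingEquiv u
  refine ⟨⟨AlgEquiv.ofRingEquiv (f := f) fun a => ?_, y, hy, ?_⟩, ?_⟩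
  · exact (hf (algebraMap k _ a)).trans (congrArg Subtype.val (g.commutes a))
  · exact (hf (coordX p k n)).trans (congrArg Subtype.val h)
  · apply Subtype.ext
    apply AlgEquiv.ext
    exact fun u => Subtype.ext (hf u)

end

/-! ### The centre of `G[n]` -/

theorem nonempty_mulEquiv_of_ker_eq {G A B : Type*} [Group G] [Group A] [Group B] {f : G →* A}
    {g : G →* B} (hf : Function.Surjective f) (hg : Function.Surjective g) (h : f.ker = g.ker) :
    Nonempty (A ≃* B) :=
  ⟨((QuotientGroup.quotientKerEquivOfSurjective f hf).symm.trans
    (QuotientGroup.quotientMulEquivOfEq h)).trans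
      (QuotientGroup.quotientKerEquivOfSurjective g hg)⟩

section

variable (p : ℕ) [hp : Fact p.Prime] {k : Type*} [Field k] [CharP k p]

theorem apply_elX_pow {σ : transGroup p k} {y : k}
    (h : σ.1 (elX k) = elX k + algebraMap k _ y) (m : ℕ) :
    (σ ^ m).1 (elX k) = elX k + algebraMap k _ (m * y) := by
  induction m with
  | zero => simp
  | succ m ih =>
    rw [pow_succ', Subgroup.coe_mul, AlgEquiv.mul_apply, ih, map_add, h, AlgEquiv.commutes,
      add_assoc, ← map_add]
    congr 2
    push_cast
    ring

theorem exists_apply_elW_eq_add_of_apply_elX_eq (i : ℕ)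
    {σ : AlgebraicClosure (RatFunc k) ≃ₐ[k] AlgebraicClosure (RatFunc k)}
    (h : σ (elX k) = elX k) :
    ∃ a : ZMod p, σ (elW p k i) = elW p k i + (a.val : AlgebraicClosure (RatFunc k)) := by
  have hσ := congrArg σ (elW_pow_sub hp.out.one_lt (k := k) i)
  rw [← aeval_algHom_apply, h, ← elW_pow_sub hp.out.one_lt, map_sub, map_pow] at hσ
  obtain ⟨a, ha⟩ := exists_zmod_val_of_pow_eq_self p (u := σ (elW p k i) - elW p k i) (by
    rw [sub_pow_char]
    linear_combination hσ)
  exact ⟨a, by rw [← ha]; ring⟩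

theorem one_mem_zerosV : (1 : k) ∈ zerosV p k := by
  rw [mem_zerosV]
  simp [hp.out.ne_zero]

theorem mem_zerosV_of_pow_sub_eq_one {y : k} (h : y ^ p - y = 1) : y ∈ zerosV p k := by
  rw [mem_zerosV, h, one_pow]

variable [IsAlgClosed k]

theorem restrictG_eq_one_iff (hp2 : p ≠ 2) {n : ℕ} (hn : n ≤ p - 1) {σ : transGroup p k} :
    restrictG p hp2 hn σ = 1 ↔
      σ.1 (elX k) = elX k ∧ ∀ i, 1 ≤ i → i ≤ n → σ.1 (elW p k i) = elW p k i := by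
  rw [← map_one (restrictG p hp2 hn), restrictG_eq_iff]
  rfl

theorem restrictG_mem_center_iff_forall (hp2 : p ≠ 2) {n : ℕ} (hn : n ≤ p - 1)
    {σ : transGroup p k} :
    restrictG p hp2 hn σ ∈ Subgroup.center (groupG p k n) ↔
      ∀ τ : transGroup p k, τ.1 (σ.1 (elX k)) = σ.1 (τ.1 (elX k)) ∧
        ∀ i, 1 ≤ i → i ≤ n → τ.1 (σ.1 (elW p k i)) = σ.1 (τ.1 (elW p k i)) := by
  rw [Subgroup.mem_center_iff, (restrictG_surjective p hp2 hn).forall]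
  refine forall_congr' fun τ => ?_
  rw [← map_mul, ← map_mul, restrictG_eq_iff]
  rfl

/-- An automorphism commuting on `W_1` with lifts of translations by `1` and by a root of
`℘(Y) = 1` fixes `X`: commutation on `W_1` with a lift of the translation by `y'` means
`℘(y') y = ℘(y) y'`. -/
theorem apply_elX_eq_of_commute (h3 : 3 ≤ p) {σ : transGroup p k}
    (h : ∀ τ : transGroup p k, τ.1 (σ.1 (elW p k 1)) = σ.1 (τ.1 (elW p k 1))) :
    σ.1 (elX k) = elX k := by
  obtain ⟨y, hy, hσ⟩ := σ.2
  obtain ⟨c, hc⟩ := exists_apply_elW_one_eq p h3 rfl ((mem_zerosV p).mp hy) hσ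
  have key : ∀ y' ∈ zerosV p k, (y' ^ p - y') * y = (y ^ p - y) * y' := by
    intro y' hy'
    obtain ⟨τ, hτ⟩ := exists_transGroup_apply_elX p hy'
    obtain ⟨c', hc'⟩ := exists_apply_elW_one_eq p h3 rfl ((mem_zerosV p).mp hy') hτ
    have e := h τ
    rw [hc, hc'] at e
    simp only [map_add, map_mul, AlgEquiv.commutes, hc, hc', hσ, hτ] at e
    apply (algebraMap k (AlgebraicClosure (RatFunc k))).injective
    simp only [map_mul]
    linear_combination -e
  obtain ⟨y₁, hy₁⟩ := exists_pow_sub_self_eq hp.out.one_lt (1 : k)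
  have e1 := key 1 (one_mem_zerosV p)
  have e2 := key y₁ (mem_zerosV_of_pow_sub_eq_one p hy₁)
  rw [one_pow, sub_self, zero_mul, mul_one] at e1
  rw [hy₁, one_mul, ← e1, zero_mul] at e2
  rw [hσ, e2, map_zero, add_zero]

theorem apply_elW_eq_of_commute (hp2 : p ≠ 2) {n : ℕ} (hn : n ≤ p - 1) {σ : transGroup p k}
    (hX : σ.1 (elX k) = elX k)
    (h : ∀ τ : transGroup p k, ∀ i, 1 ≤ i → i ≤ n →
      τ.1 (σ.1 (elW p k i)) = σ.1 (τ.1 (elW p k i)))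
    {i : ℕ} (h1 : 1 ≤ i) (hi : i < n) : σ.1 (elW p k i) = elW p k i := by
  obtain ⟨y, hy⟩ := exists_pow_sub_self_eq hp.out.one_lt (1 : k)
  obtain ⟨τ, hτ⟩ := exists_transGroup_apply_elX p (mem_zerosV_of_pow_sub_eq_one p hy)
  induction i using Nat.strong_induction_on with
  | _ i ih =>
    obtain ⟨i, rfl⟩ := Nat.exists_eq_add_of_le' h1
    obtain ⟨P, hP⟩ := exists_apply_elW_eq p hp2 (show i + 1 + 1 ≤ p - 1 by omega) hy (one_pow p) hτ
    obtain ⟨a, ha⟩ := exists_apply_elW_eq_add_of_apply_elX_eq p (i + 1 + 1) hX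
    have e := h τ (i + 1 + 1) (by omega) (by omega)
    rw [ha, map_add, map_natCast, hP, map_add, map_sum, ← aeval_algHom_apply, hX,
      Finset.sum_range_succ', Finset.sum_range_succ', Finset.sum_range_succ',
      Finset.sum_range_succ'] at e
    -- by induction `σ` fixes all terms of `τ W_{i + 2}` but the first two
    have ht : ∀ j ∈ Finset.range i,
        σ.1 (algebraMap k _ (1 ^ (j + 1 + 1) / ((j + 1 + 1).factorial : k)) *
          elW p k (i + 1 + 1 - (j + 1 + 1))) =
        algebraMap k _ (1 ^ (j + 1 + 1) / ((j + 1 + 1).factorial : k)) *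
          elW p k (i + 1 + 1 - (j + 1 + 1)) := by
      intro j hj
      rw [Finset.mem_range] at hj
      rw [map_mul, AlgEquiv.commutes, ih _ (by omega) (by omega) (by omega)]
    rw [Finset.sum_congr rfl ht] at e
    simp only [zero_add, pow_zero, pow_one, Nat.factorial_zero, Nat.factorial_one, Nat.cast_one,
      div_one, map_one, one_mul, Nat.sub_zero, Nat.add_sub_cancel, ha] at e
    linear_combination -e

theorem restrictG_mem_center_iff (h3 : 3 ≤ p) {m : ℕ} (hm : m + 1 ≤ p - 1) (hm' : m ≤ p - 1)
    {σ : transGroup p k} :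
    restrictG p (by omega) hm σ ∈ Subgroup.center (groupG p k (m + 1)) ↔
      restrictG p (by omega) hm' σ = 1 := by
  rw [restrictG_mem_center_iff_forall, restrictG_eq_one_iff]
  constructor
  · intro h
    have hX := apply_elX_eq_of_commute p h3 fun τ => (h τ).2 1 le_rfl (by omega)
    exact ⟨hX, fun i h1 hi => apply_elW_eq_of_commute p (by omega) hm hX (fun τ => (h τ).2) h1
      (by omega)⟩
  · rintro ⟨hX, hW⟩ τ
    obtain ⟨y, hy, hτ⟩ := τ.2
    have hs := (mem_zerosV p).mp hy
    have hfix : ∀ u ∈ funField p k m, σ.1 u = u := fun u hu =>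
      apply_eq_of_forall_elW p (τ := 1) hX hW hu
    have hmem : ∀ u ∈ funField p k m, τ.1 u ∈ funField p k m := fun u hu =>
      apply_mem_funField p (by omega) hm' τ.2 hu
    refine ⟨by rw [hX, hfix _ (hmem _ (elX_mem_funField p m))], fun i h1 hi => ?_⟩
    rcases Nat.lt_or_eq_of_le hi with hi | rfl
    · have hw := elW_mem_funField p (k := k) h1 (show i ≤ m by omega)
      rw [hfix _ hw, hfix _ (hmem _ hw)]
    · -- `τ W_{m + 1} - W_{m + 1}` lies in `K_m`
      obtain ⟨P, hP⟩ := exists_apply_elW_eq p (by omega) hm rfl hs hτ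
      obtain ⟨a, ha⟩ := exists_apply_elW_eq_add_of_apply_elX_eq p (m + 1) hX
      have hd : τ.1 (elW p k (m + 1)) - elW p k (m + 1) ∈ funField p k m := by
        rw [hP, Finset.sum_range_succ', add_right_comm]
        simp only [pow_zero, Nat.factorial_zero, Nat.cast_one, div_one, map_one, one_mul,
          Nat.sub_zero, add_sub_cancel_right]
        refine add_mem (sum_mem fun j hj => mul_mem ?_ ?_) (aeval_elX_mem_funField p m P)
        · rw [← aeval_C (elX k)]
          exact aeval_elX_mem_funField p m _
        · rw [Finset.mem_range] at hj
          exact elW_mem_funField p (by omega) (by omega)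
      have e := hfix _ hd
      rw [map_sub, ha] at e
      rw [ha, map_add, map_natCast]
      linear_combination -e

/-- `G[m]` is the quotient of `G[m + 1]` by its centre. -/
theorem nonempty_mulEquiv_quotient_center (h3 : 3 ≤ p) {m : ℕ} (hm : m + 1 ≤ p - 1) :
    Nonempty (groupG p k m ≃* groupG p k (m + 1) ⧸ Subgroup.center (groupG p k (m + 1))) := by
  have hm' : m ≤ p - 1 := by omega
  refine nonempty_mulEquiv_of_ker_eq (restrictG_surjective p (by omega) hm')
    ((QuotientGroup.mk'_surjective _).comp (restrictG_surjective p (by omega) hm))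
    (g := (QuotientGroup.mk' _).comp (restrictG p (by omega) hm)) ?_
  ext σ
  rw [MonoidHom.mem_ker, MonoidHom.mem_ker, MonoidHom.comp_apply, QuotientGroup.mk'_apply,
    QuotientGroup.eq_one_iff, restrictG_mem_center_iff p h3 hm hm']

end

/-! ### Orders and exponents -/

theorem isExtraspecial_of_mulEquiv {p : ℕ} {A G : Type*} [Group A] [Nontrivial A] [Group G]
    (e : A ≃* G ⧸ Subgroup.center G) (hfin : Finite G) (hG : IsPGroup p G)
    (hZ : Nat.card (Subgroup.center G) = p) (hcomm : ∀ a b : A, a * b = b * a)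
    (hpow : ∀ a : A, a ^ p = 1) : IsExtraspecial p G where
  finite := hfin
  isPGroup := hG
  card_center := hZ
  nontrivial := e.symm.toEquiv.nontrivial
  mul_comm x y := e.symm.injective (by rw [map_mul, map_mul, hcomm])
  pow_eq_one x := e.symm.injective (by rw [map_pow, map_one, hpow])

section

variable (p : ℕ) [hp : Fact p.Prime] {k : Type*} [Field k] [CharP k p]

theorem transGroup_pow_apply_elX (σ : transGroup p k) : (σ ^ p).1 (elX k) = elX k := by
  obtain ⟨y, -, hσ⟩ := σ.2
  rw [apply_elX_pow p hσ, CharP.cast_eq_zero, zero_mul, map_zero, add_zero]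

variable [IsAlgClosed k]

theorem card_zerosV : Nat.card (zerosV p k) = p ^ 2 := by
  have hp1 := hp.out.one_lt
  have hS : (polyS p k).natDegree = p := by
    rw [polyS, wp, natDegree_sub_eq_left_of_natDegree_lt] <;> simp [hp1]
  have hQ : (polyQ p k).natDegree = p ^ 2 := by
    rw [polyQ, wp, natDegree_sub_eq_left_of_natDegree_lt] <;> rw [natDegree_pow, hS]
    · rw [sq]
    · nlinarith
  have hsep : (polyQ p k).Separable := by
    have hd : derivative (polyQ p k) = 1 := by
      simp [polyQ, polyS, wp, derivative_pow]
    rw [Polynomial.Separable, hd]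
    exact isCoprime_one_right
  have h0 : polyQ p k ≠ 0 := by
    intro h
    rw [h, natDegree_zero] at hQ
    exact (pow_ne_zero 2 hp.out.ne_zero) hQ.symm
  rw [← hQ, ← card_rootSet_eq_natDegree (K := k) hsep (IsAlgClosed.splits _),
    ← Nat.card_eq_fintype_card]
  apply Nat.card_congr
  refine Equiv.setCongr ?_
  ext y
  rw [mem_rootSet, and_iff_right h0, coe_aeval_eq_eval]
  rfl

/-- `G[0]` is the group `V` of translations. -/
theorem card_groupG_zero (hp2 : p ≠ 2) : Nat.card (groupG p k 0) = p ^ 2 := by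
  rw [← card_zerosV p (k := k)]
  choose τ hτ using fun y : zerosV p k => exists_transGroup_apply_elX p y.2
  symm
  refine Nat.card_eq_of_bijective (fun y => restrictG p hp2 (Nat.zero_le _) (τ y)) ⟨?_, ?_⟩
  · intro y z h
    have e := ((restrictG_eq_iff p hp2 (Nat.zero_le _)).mp h).1
    rw [hτ, hτ] at e
    exact Subtype.ext (elX_add_algebraMap_injective e)
  · intro g
    obtain ⟨σ, rfl⟩ := restrictG_surjective p hp2 (Nat.zero_le _) g
    obtain ⟨y, hy, h⟩ := σ.2
    refine ⟨⟨y, hy⟩, (restrictG_eq_iff p hp2 (Nat.zero_le _)).mpr ⟨?_, fun i h1 h0 => by omega⟩⟩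
    rw [hτ, h]

theorem groupG_zero_mul_comm (hp2 : p ≠ 2) (g h : groupG p k 0) : g * h = h * g := by
  obtain ⟨σ, rfl⟩ := restrictG_surjective p hp2 (Nat.zero_le _) g
  obtain ⟨τ, rfl⟩ := restrictG_surjective p hp2 (Nat.zero_le _) h
  obtain ⟨y, -, hσ⟩ := σ.2
  obtain ⟨z, -, hτ⟩ := τ.2
  rw [← map_mul, ← map_mul, restrictG_eq_iff]
  refine ⟨?_, fun i h1 h0 => by omega⟩
  simp only [Subgroup.coe_mul, AlgEquiv.mul_apply, hσ, hτ, map_add, AlgEquiv.commutes]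
  ring

theorem groupG_zero_pow (hp2 : p ≠ 2) (g : groupG p k 0) : g ^ p = 1 := by
  obtain ⟨σ, rfl⟩ := restrictG_surjective p hp2 (Nat.zero_le _) g
  rw [← map_pow, restrictG_eq_one_iff]
  exact ⟨transGroup_pow_apply_elX p σ, fun i h1 h0 => by omega⟩

/-- The central elements of `G[m + 1]` are determined by `W_{m + 1} ↦ W_{m + 1} + a` with `a` in
the prime field. -/
theorem exists_lift_of_mem_center (h3 : 3 ≤ p) {m : ℕ} (hm : m + 1 ≤ p - 1) (hm' : m ≤ p - 1)
    (z : Subgroup.center (groupG p k (m + 1))) :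
    ∃ (a : ZMod p) (σ : transGroup p k), restrictG p (by omega) hm σ = z ∧
      restrictG p (by omega) hm' σ = 1 ∧ σ.1 (elW p k (m + 1)) = elW p k (m + 1) + (a.val : _) := by
  obtain ⟨σ, hσ⟩ := restrictG_surjective p (by omega) hm z.1
  have h1 := (restrictG_mem_center_iff p h3 hm hm' (σ := σ)).mp (hσ ▸ z.2)
  obtain ⟨a, ha⟩ := exists_apply_elW_eq_add_of_apply_elX_eq p (m + 1)
    ((restrictG_eq_one_iff p (by omega) hm').mp h1).1
  exact ⟨a, σ, hσ, h1, ha⟩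

theorem card_center_le (h3 : 3 ≤ p) {m : ℕ} (hm : m + 1 ≤ p - 1) :
    Finite (Subgroup.center (groupG p k (m + 1))) ∧
      Nat.card (Subgroup.center (groupG p k (m + 1))) ≤ p := by
  have hm' : m ≤ p - 1 := by omega
  choose a σ h1 h2 ha using exists_lift_of_mem_center p h3 hm hm' (k := k)
  have hinj : Function.Injective a := by
    intro z z' hz
    apply Subtype.ext
    rw [← h1 z, ← h1 z', restrictG_eq_iff]
    have e := (restrictG_eq_one_iff p (by omega) hm').mp (h2 z)
    have e' := (restrictG_eq_one_iff p (by omega) hm').mp (h2 z')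
    refine ⟨by rw [e.1, e'.1], fun i hi1 hi => ?_⟩
    rcases Nat.lt_or_eq_of_le hi with hi | rfl
    · rw [e.2 i hi1 (by omega), e'.2 i hi1 (by omega)]
    · rw [ha, ha, hz]
  refine ⟨Finite.of_injective a hinj, ?_⟩
  simpa using Nat.card_le_card_of_injective a hinj

theorem center_pow_eq_one (h3 : 3 ≤ p) {m : ℕ} (hm : m + 1 ≤ p - 1)
    (z : Subgroup.center (groupG p k (m + 1))) : z ^ p = 1 := by
  have hm' : m ≤ p - 1 := by omega
  obtain ⟨a, σ, h1, h2, ha⟩ := exists_lift_of_mem_center p h3 hm hm' z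
  have hpow : ∀ j : ℕ, (σ ^ j).1 (elW p k (m + 1)) =
      elW p k (m + 1) + (j : AlgebraicClosure (RatFunc k)) * (a.val : _) := by
    intro j
    induction j with
    | zero => simp
    | succ j ih =>
      rw [pow_succ', Subgroup.coe_mul, AlgEquiv.mul_apply, ih, map_add, ha, map_mul, map_natCast,
        map_natCast]
      push_cast
      ring
  have e := (restrictG_eq_one_iff p (by omega) hm').mp
    (show restrictG p (by omega) hm' (σ ^ p) = 1 by rw [map_pow, h2, one_pow])
  apply Subtype.ext
  rw [Subgroup.coe_pow, ← h1, ← map_pow, Subgroup.coe_one, restrictG_eq_one_iff]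
  refine ⟨e.1, fun i hi1 hi => ?_⟩
  rcases Nat.lt_or_eq_of_le hi with hi | rfl
  · exact e.2 i hi1 (by omega)
  · rw [hpow, CharP.cast_eq_zero, zero_mul, add_zero]

/-- The centre of `G[m + 1]` embeds in the prime field, and it is not trivial because `G[m + 1]` is
a nontrivial `p`-group. -/
theorem card_groupG_and_card_center (h3 : 3 ≤ p) {m : ℕ} (hm : m + 1 ≤ p - 1)
    (ih : Nat.card (groupG p k m) = p ^ (m + 2)) :
    Nat.card (groupG p k (m + 1)) = p ^ (m + 3) ∧
      Nat.card (Subgroup.center (groupG p k (m + 1))) = p := by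
  obtain ⟨e⟩ := nonempty_mulEquiv_quotient_center p (k := k) h3 hm
  obtain ⟨hfin, hle⟩ := card_center_le p (k := k) h3 hm
  have hcard := Subgroup.card_eq_card_quotient_mul_card_subgroup
    (Subgroup.center (groupG p k (m + 1)))
  rw [← Nat.card_congr e.toEquiv, ih] at hcard
  have hZ : IsPGroup p (Subgroup.center (groupG p k (m + 1))) := fun z =>
    ⟨1, by rw [pow_one, center_pow_eq_one p h3 hm]⟩
  obtain ⟨a, ha⟩ := IsPGroup.iff_card.mp hZ
  rw [ha, ← pow_add] at hcard
  have hG : IsPGroup p (groupG p k (m + 1)) := IsPGroup.of_card hcard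
  have h1 : 1 < Nat.card (groupG p k (m + 1)) := by
    rw [hcard]
    exact Nat.one_lt_pow (by omega) hp.out.one_lt
  have : Finite (groupG p k (m + 1)) := Nat.finite_of_card_ne_zero (by omega)
  have : Nontrivial (groupG p k (m + 1)) := Finite.one_lt_card_iff_nontrivial.mp h1
  have hnt := Finite.one_lt_card_iff_nontrivial.mpr hG.center_nontrivial
  rw [ha] at hle hnt
  have ha1 : a = 1 := by
    apply le_antisymm
    · exact (Nat.pow_le_pow_iff_right hp.out.one_lt).mp (by simpa using hle)
    · by_contra h
      simp [show a = 0 by omega] at hnt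
  subst ha1
  exact ⟨hcard, by rw [ha, pow_one]⟩

theorem card_groupG (h3 : 3 ≤ p) {n : ℕ} (hn : n ≤ p - 1) :
    Nat.card (groupG p k n) = p ^ (n + 2) := by
  induction n with
  | zero => exact card_groupG_zero p (by omega)
  | succ m ih => exact (card_groupG_and_card_center p h3 hn (ih (by omega))).1

theorem isExtraspecial_groupG_one (h3 : 3 ≤ p) : IsExtraspecial p (groupG p k 1) := by
  have hp2 : p ≠ 2 := by omega
  have hpos (n : ℕ) : p ^ n ≠ 0 := pow_ne_zero _ hp.out.ne_zero
  obtain ⟨hcard, hZ⟩ := card_groupG_and_card_center p (k := k) h3 (m := 0) (by omega)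
    (card_groupG p h3 (by omega))
  have h0 := card_groupG_zero p (k := k) hp2
  have : Finite (groupG p k 0) := Nat.finite_of_card_ne_zero (h0 ▸ hpos 2)
  have : Nontrivial (groupG p k 0) := by
    rw [← Finite.one_lt_card_iff_nontrivial, h0]
    exact Nat.one_lt_pow (by omega) hp.out.one_lt
  obtain ⟨e⟩ := nonempty_mulEquiv_quotient_center p (k := k) h3 (m := 0) (by omega)
  exact isExtraspecial_of_mulEquiv e (Nat.finite_of_card_ne_zero (hcard ▸ hpos _))
    (IsPGroup.of_card hcard) hZ (groupG_zero_mul_comm p hp2) (groupG_zero_pow p hp2)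

/-- `G[1]` is killed by `p`, since `p` divides `p choose 2`: if `σ` sends `X` to `X + y` and
`W_1` to `W_1 + s X + c`, then `σ ^ m` sends `W_1` to
`W_1 + m s X + m c + (m choose 2) s y`. -/
theorem groupG_one_pow (h3 : 3 ≤ p) (g : groupG p k 1) : g ^ p = 1 := by
  obtain ⟨σ, rfl⟩ := restrictG_surjective p (show p ≠ 2 by omega) (show 1 ≤ p - 1 by omega) g
  rw [← map_pow, restrictG_eq_one_iff]
  refine ⟨transGroup_pow_apply_elX p σ, fun i h1 hi => ?_⟩
  obtain rfl : i = 1 := by omega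
  obtain ⟨y, hy, hσ⟩ := σ.2
  obtain ⟨c, hc⟩ := exists_apply_elW_one_eq p h3 rfl ((mem_zerosV p).mp hy) hσ
  set s := y ^ p - y
  have hpow : ∀ m : ℕ, (σ ^ m).1 (elW p k 1) = elW p k 1 + algebraMap k _ (m * s) * elX k +
      algebraMap k _ (m * c + (m.choose 2 : ℕ) * (s * y)) := by
    intro m
    induction m with
    | zero => simp
    | succ m ih =>
      rw [pow_succ', Subgroup.coe_mul, AlgEquiv.mul_apply, ih]
      have hch : (m + 1).choose 2 = m + m.choose 2 := by
        rw [Nat.choose_succ_succ' m 1, Nat.choose_one_right]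
      simp only [map_add, map_mul, AlgEquiv.commutes, hc, hσ, hch, Nat.cast_add, Nat.cast_one,
        map_one]
      ring
  rw [hpow, CharP.cast_eq_zero k p, (CharP.cast_eq_zero_iff k p _).mpr
    (hp.out.dvd_choose_self (by omega) (by omega))]
  simp

theorem exponent_groupG_one (h3 : 3 ≤ p) : Monoid.exponent (groupG p k 1) = p := by
  rcases (Nat.dvd_prime hp.out).mp (Monoid.exponent_dvd_of_forall_pow_eq_one
    (groupG_one_pow p h3 (k := k))) with h | h
  · have := Monoid.exp_eq_one_iff.mp h
    have hc := card_groupG p (k := k) h3 (n := 1) (by omega)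
    rw [Nat.card_of_subsingleton 1] at hc
    have := Nat.one_lt_pow (n := 1 + 2) (by omega) hp.out.one_lt
    omega
  · exact h

end

/-! ### Extraspecial groups of order `p ^ 3` and exponent `p` -/

section

variable (p : ℕ) [hp : Fact p.Prime]

theorem pow_val_add {E : Type*} [Group E] {x : E} (hx : x ^ p = 1) (a b : ZMod p) :
    x ^ (a + b).val = x ^ a.val * x ^ b.val := by
  rw [ZMod.val_add, ← pow_eq_pow_mod _ hx, pow_add]

theorem pow_val_mul {E : Type*} [Group E] {x : E} (hx : x ^ p = 1) (a b : ZMod p) :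
    x ^ (a * b).val = x ^ (a.val * b.val) := by
  rw [ZMod.val_mul, ← pow_eq_pow_mod _ hx]

/-- An extraspecial group of order `p ^ 3` and exponent `p` is a Heisenberg group: if `x` and `y`
do not commute and `z` is their commutator, every element is `x ^ a * y ^ b * z ^ c` for unique
`a b c : ZMod p`, and the multiplication is polynomial in these coordinates. -/
theorem exists_heisenberg_coordinates {E : Type*} [Group E] (hE : IsExtraspecial p E)
    (hcard : Nat.card E = p ^ 3) (hexp : Monoid.exponent E = p) :
    ∃ φ : ZMod p × ZMod p × ZMod p ≃ E, ∀ u v,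
      φ u * φ v = φ (u.1 + v.1, u.2.1 + v.2.1, u.2.2 + v.2.2 + u.2.1 * v.1) := by
  have hpow : ∀ g : E, g ^ p = 1 := fun g => hexp ▸ Monoid.pow_exponent_eq_one g
  obtain ⟨x, y, hxy⟩ : ∃ x y : E, x * y ≠ y * x := by
    by_contra! h
    have htop : Subgroup.center E = ⊤ := by
      rw [eq_top_iff]
      exact fun g _ => Subgroup.mem_center_iff.mpr fun a => h a g
    have := hE.nontrivial
    rw [htop] at this
    exact not_subsingleton (E ⧸ (⊤ : Subgroup E)) QuotientGroup.subsingleton_quotient_top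
  obtain ⟨z, hyx⟩ : ∃ z, y * x = x * y * z := ⟨(x * y)⁻¹ * (y * x), by group⟩
  have hzc : z ∈ Subgroup.center E := by
    rw [← QuotientGroup.eq_one_iff]
    have h := congrArg (QuotientGroup.mk (s := Subgroup.center E)) hyx
    rw [QuotientGroup.mk_mul, QuotientGroup.mk_mul, QuotientGroup.mk_mul, hE.mul_comm y x] at h
    exact mul_eq_left.mp h.symm
  have hz1 : z ≠ 1 := by
    rintro rfl
    exact hxy (by rw [hyx, mul_one])
  have hzcomm : ∀ g, Commute z g := fun g => (Subgroup.mem_center_iff.mp hzc g).symm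
  have hord : orderOf z = p := orderOf_eq_prime (hpow z) hz1
  have hinj : ∀ a b : ZMod p, z ^ a.val = z ^ b.val → a = b := by
    intro a b h
    apply ZMod.val_injective p
    exact pow_injOn_Iio_orderOf (by rw [hord]; exact ZMod.val_lt a)
      (by rw [hord]; exact ZMod.val_lt b) h
  -- moving powers of `y` past powers of `x`
  have h1 : ∀ j : ℕ, y ^ j * x = x * y ^ j * z ^ j := by
    intro j
    induction j with
    | zero => simp
    | succ j ih =>
      calc y ^ (j + 1) * x = y ^ j * (y * x) := by rw [pow_succ, mul_assoc]
        _ = (y ^ j * x) * y * z := by rw [hyx]; simp only [mul_assoc]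
        _ = x * y ^ j * (z ^ j * y) * z := by rw [ih]; simp only [mul_assoc]
        _ = x * y ^ j * (y * z ^ j) * z := by rw [((hzcomm y).pow_left j).eq]
        _ = x * y ^ (j + 1) * z ^ (j + 1) := by simp only [pow_succ, mul_assoc]
  have h2 : ∀ i j : ℕ, y ^ j * x ^ i = x ^ i * y ^ j * z ^ (j * i) := by
    intro i j
    induction i with
    | zero => simp
    | succ i ih =>
      calc y ^ j * x ^ (i + 1) = (y ^ j * x ^ i) * x := by rw [pow_succ, mul_assoc]
        _ = x ^ i * y ^ j * (z ^ (j * i) * x) := by rw [ih]; simp only [mul_assoc]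
        _ = x ^ i * (y ^ j * x) * z ^ (j * i) := by
          rw [((hzcomm x).pow_left _).eq]; simp only [mul_assoc]
        _ = x ^ (i + 1) * y ^ j * (z ^ j * z ^ (j * i)) := by
          rw [h1, pow_succ]; simp only [mul_assoc]
        _ = x ^ (i + 1) * y ^ j * z ^ (j * (i + 1)) := by
          rw [← pow_add, Nat.mul_succ, add_comm j (j * i)]
  let f : ZMod p × ZMod p × ZMod p → E := fun u => x ^ u.1.val * y ^ u.2.1.val * z ^ u.2.2.val
  have hmul : ∀ u v, f u * f v =
      f (u.1 + v.1, u.2.1 + v.2.1, u.2.2 + v.2.2 + u.2.1 * v.1) := by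
    rintro ⟨a, b, c⟩ ⟨a', b', c'⟩
    simp only [f]
    have hc (n : ℕ) (g : E) : z ^ n * g = g * z ^ n := ((hzcomm g).pow_left n).eq
    calc x ^ a.val * y ^ b.val * z ^ c.val * (x ^ a'.val * y ^ b'.val * z ^ c'.val)
        = x ^ a.val * (y ^ b.val * x ^ a'.val) * y ^ b'.val * (z ^ c.val * z ^ c'.val) := by
          rw [mul_assoc _ (z ^ c.val), hc c.val]
          simp only [mul_assoc]
          rw [hc c'.val (z ^ c.val)]
      _ = x ^ a.val * x ^ a'.val * (y ^ b.val * (z ^ (b.val * a'.val) * y ^ b'.val)) *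
          (z ^ c.val * z ^ c'.val) := by rw [h2]; simp only [mul_assoc]
      _ = x ^ a.val * x ^ a'.val * (y ^ b.val * y ^ b'.val) *
          (z ^ c.val * z ^ c'.val * z ^ (b.val * a'.val)) := by
          rw [hc (b.val * a'.val) (y ^ b'.val), ← hc (b.val * a'.val) (z ^ c.val * z ^ c'.val)]
          simp only [mul_assoc]
      _ = _ := by
          rw [pow_val_add p (hpow x), pow_val_add p (hpow y), pow_val_add p (hpow z),
            pow_val_add p (hpow z), pow_val_mul p (hpow z)]
  have hfinj : Function.Injective f := by
    rintro ⟨a, b, c⟩ ⟨a', b', c'⟩ h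
    -- the exponents of `x` and `y` are read off from commutators with `y` and `x`
    have hz (a b c d : ZMod p) : f (a, b, c + d) = f (a, b, c) * z ^ d.val := by
      simp only [f, pow_val_add p (hpow z), mul_assoc]
    have hX (a b c : ZMod p) :
        f (a, b, c) * f (1, 0, 0) = f (1, 0, 0) * f (a, b, c) * z ^ b.val := by
      simp only [hmul, ← hz, add_zero, zero_add, mul_one, zero_mul, add_comm a 1]
    have hY (a b c : ZMod p) :
        f (0, 1, 0) * f (a, b, c) = f (a, b, c) * f (0, 1, 0) * z ^ a.val := by
      simp only [hmul, ← hz, add_zero, zero_add, one_mul, mul_zero, add_comm b 1]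
    obtain rfl : b = b' := hinj _ _ (by
      have := hX a b c
      rw [h, hX a' b' c'] at this
      exact (mul_left_cancel this).symm)
    obtain rfl : a = a' := hinj _ _ (by
      have := hY a b c
      rw [h, hY a' b c'] at this
      exact (mul_left_cancel this).symm)
    obtain rfl : c = c' := hinj _ _ (mul_left_cancel h)
    rfl
  have : Finite E := hE.finite
  have hbij : Function.Bijective f := (Nat.bijective_iff_injective_and_card f).mpr
    ⟨hfinj, by rw [hcard, Nat.card_prod, Nat.card_prod, Nat.card_zmod]; ring⟩
  exact ⟨Equiv.ofBijective f hbij, hmul⟩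

theorem nonempty_mulEquiv_of_isExtraspecial {E E' : Type*} [Group E] [Group E']
    (hE : IsExtraspecial p E) (hcard : Nat.card E = p ^ 3) (hexp : Monoid.exponent E = p)
    (hE' : IsExtraspecial p E') (hcard' : Nat.card E' = p ^ 3) (hexp' : Monoid.exponent E' = p) :
    Nonempty (E ≃* E') := by
  obtain ⟨φ, hφ⟩ := exists_heisenberg_coordinates p hE hcard hexp
  obtain ⟨ψ, hψ⟩ := exists_heisenberg_coordinates p hE' hcard' hexp'
  refine ⟨MulEquiv.mk' (φ.symm.trans ψ) fun g h => ?_⟩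
  simp only [Equiv.trans_apply]
  rw [hψ, ← φ.apply_symm_apply g, ← φ.apply_symm_apply h, hφ]
  simp

end

theorem map_center_eq_of_mulEquiv {G H : Type*} [Group G] [Group H] (e : G ≃* H) :
    (Subgroup.center G).map (e : G →* H) = Subgroup.center H := by
  ext h
  refine Subgroup.mem_map_equiv.trans ?_
  rw [Subgroup.mem_center_iff, Subgroup.mem_center_iff, e.surjective.forall]
  refine forall_congr' fun g => ?_
  rw [← e.injective.eq_iff, map_mul, map_mul, e.apply_symm_apply]

/-- For finite groups capability does not depend on the universe of the group `Γ`. -/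
theorem IsCapable.of_mulEquiv_quotient_center.{u, v} {E : Type u} [Group E] {Γ : Type v} [Group Γ]
    [Finite Γ] (e : E ≃* Γ ⧸ Subgroup.center Γ) : IsCapable E := by
  let s : Shrink.{u} Γ ≃* Γ := Shrink.mulEquiv
  refine ⟨Shrink.{u} Γ, inferInstance, ⟨e.trans (QuotientGroup.congr _ _ s.symm ?_)⟩⟩
  exact map_center_eq_of_mulEquiv s.symm

theorem corollary6p9 (p : ℕ) [Fact p.Prime] (hp : 3 ≤ p)
    (k : Type*) [Field k] [IsAlgClosed k] [CharP k p] :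
    (∀ n : ℕ, 2 ≤ n → n ≤ p - 1 →
      Nonempty (groupG p k (n - 1) ≃* groupG p k n ⧸ Subgroup.center (groupG p k n)) ∧
      IsCapable (groupG p k (n - 1))) ∧
    (IsExtraspecial p (groupG p k 1) ∧ Nat.card (groupG p k 1) = p ^ 3 ∧
      Monoid.exponent (groupG p k 1) = p) ∧
    (∀ (E : Type*) [Group E], IsExtraspecial p E → Nat.card E = p ^ 3 →
      Monoid.exponent E = p →
      Nonempty (E ≃* groupG p k 2 ⧸ Subgroup.center (groupG p k 2)) ∧ IsCapable E) ∧
    Nat.card (groupG p k 2) = p ^ 4 := by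
  have h1 := isExtraspecial_groupG_one p (k := k) hp
  have hc1 : Nat.card (groupG p k 1) = p ^ 3 := card_groupG p hp (by omega)
  have hc2 : Nat.card (groupG p k 2) = p ^ 4 := card_groupG p hp (by omega)
  have he1 := exponent_groupG_one p (k := k) hp
  refine ⟨fun n h2 hn => ?_, ⟨h1, hc1, he1⟩, fun E _ hE hcard hexp => ?_, hc2⟩
  · obtain ⟨m, rfl⟩ := Nat.exists_eq_add_of_le' (show 1 ≤ n by omega)
    obtain ⟨e⟩ := nonempty_mulEquiv_quotient_center p (k := k) hp hn
    exact ⟨⟨e⟩, ⟨_, inferInstance, ⟨e⟩⟩⟩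
  · obtain ⟨e⟩ := nonempty_mulEquiv_of_isExtraspecial p hE hcard hexp h1 hc1 he1
    obtain ⟨e'⟩ := nonempty_mulEquiv_quotient_center p (k := k) hp (m := 1) (by omega)
    have : Finite (groupG p k 2) := Nat.finite_of_card_ne_zero (by
      rw [hc2]
      exact pow_ne_zero _ (Fact.out : p.Prime).ne_zero)
    exact ⟨⟨e.trans e'⟩, .of_mulEquiv_quotient_center (e.trans e')⟩
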